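/- All graphs are finite and simple. For a graph $G$ with $n$ vertices let $p(G,r)$ be the number of matchings in $G$ with exactly $r$ edges, let $$\mu(G,x)=\sum_{r=0}^{\lfloor n/2\rfloor}(-1)^r\,p(G,r)\,x^{n-2r}$$ be the matching polynomial of $G$, and for a real number $\theta$ let $\mathrm{mult}(\theta,G)\ge 0$ be the multiplicity of $\theta$ as a root of $\mu(G,x)$ (with $\mathrm{mult}(\theta,G)=0$ if $\theta$ is not a root). For $S\subseteq V(G)$ let $G\setminus S$ be the graph obtained from $G$ by deleting the vertices in $S$ and all edges containing them. A set $X\subseteq V(G)$ with $|X|>1$ is called $\theta$-nice in $G$ if $\mathrm{mult}(\theta,G\setminus\{u,v\})=\mathrm{mult}(\theta,G)+2$ for all $u,v\in X$ with $u\neq v$. For a set $M$ of edges let $V(M)$ be the set of end points of the edges in $M$. **Theorem.** Let $\theta$ be a real number, let $G$ be a graph, let $X=\{x_1,\dots,x_m\}$ (with $x_1,\dots,x_m$ distinct) be $\theta$-nice in $G$, and let $\mathrm{mult}(\theta,G)=k$ (where $k=0$ is allowed). Then there is a set $Y=\{y_1,\dots,y_m\}\subseteq V(G)$ of $m$ vertices,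 disjoint from $X$, such that 1. $M=\{x_1y_1,\dots,x_my_m\}$ is a matching of size $m$ in $G$; 2. for every $M'\subseteq M$ we have $\mathrm{mult}(\theta,G\setminus V(M'))=k$, and if $|X\setminus V(M')|\ge 2$, then $X\setminus V(M')$ is $\theta$-nice in $G\setminus V(M')$; 3. $Y$ is an independent set in $G$. -/

import Mathlib

open Polynomial

namespace SimpleGraph

variable {V : Type*}

/-- A matching in `G`, given as a set of edges of `G`, no two of which have a vertex in common. -/
def IsEdgeMatching (G : SimpleGraph V) (M : Set (Sym2 V)) : Prop :=
  M ⊆ G.edgeSet ∧ ∀ e ∈ M, ∀ f ∈ M, e ≠ f → ∀ v, v ∈ e → v ∉ f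

/-- The number `p(G, r)` of matchings with exactly `r` edges in the finite graph `G`. -/
noncomputable def numMatchings (G : SimpleGraph V) (r : ℕ) : ℕ :=
  Set.ncard {M : Set (Sym2 V) | G.IsEdgeMatching M ∧ M.ncard = r}

/-- The matching polynomial `μ(G, x) = ∑_{r = 0}^{⌊n/2⌋} (-1)^r p(G, r) x^(n - 2r)` of a finite
graph `G` with `n` vertices. -/
noncomputable def matchingPolynomial (G : SimpleGraph V) : ℝ[X] :=
  ∑ r ∈ Finset.range (Nat.card V / 2 + 1),
    C ((-1 : ℝ) ^ r * (G.numMatchings r : ℝ)) * X ^ (Nat.card V - 2 * r)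

/-- `mult(θ, G)`: the multiplicity of `θ` as a root of the matching polynomial of `G`
(it is `0` when `θ` is not a root). -/
noncomputable def mult (θ : ℝ) (G : SimpleGraph V) : ℕ :=
  G.matchingPolynomial.rootMultiplicity θ

/-- `G ∖ S`: the graph obtained from `G` by deleting the vertices in `S` and all edges that
contain one of them. -/
abbrev del (G : SimpleGraph V) (S : Set V) : SimpleGraph ↥(Sᶜ) :=
  G.induce Sᶜ

/-- A set `X` of at least two vertices is `θ`-nice in `G` if
`mult(θ, G ∖ uv) = mult(θ, G) + 2` for all distinct `u, v` in `X`. -/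
def IsNice (θ : ℝ) (G : SimpleGraph V) (X : Set V) : Prop :=
  1 < X.ncard ∧ ∀ u ∈ X, ∀ v ∈ X, u ≠ v → mult θ (G.del {u, v}) = mult θ G + 2

/-- `V(M)`: the set of end points of the edges in `M`. -/
def coveredVerts (M : Set (Sym2 V)) : Set V :=
  {v | ∃ e ∈ M, v ∈ e}

end SimpleGraph

/-! Let `f A` be the matching polynomial of the subgraph induced on `A`, translated by `θ`; its
order of vanishing at `0` (`natTrailingDegree`) is the multiplicity of `θ`. Everything rests on the
vertex recursion of `f`. It gives a Rayleigh inequality for real vertex weights (`rayleigh`) and a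
lower bound for the Wronskian of `f A` and `f (A - u)` (`wronskian`). From the latter, deleting a
vertex changes the order by at most one, and when the order does change, its direction fixes the
relative sign of the two lowest coefficients.

Niceness speaks of pairs only. The discriminant of the Rayleigh quadratic extends it to triples
(`natTrailingDegree_erase_three`), so deleting any `S ⊆ X` raises the order by exactly `|S|`
(`IsRaising.sdiff`). Deleting a further set `T` then leaves order at least `k + |S| - |T|`, and the
coefficient of that degree has a sign depending only on `|S|` and `f A`, or is zero (`coeff_sign`).

Hence the lowest terms in the vertex recursion cannot cancel. A nonzero term yields a partner `y`
for each `x` (`exists_adj`); absence of cancellation lets pairs be dropped from the matching at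
order `k` (`of_insert`) and forbids edges between partners (`not_adj`). -/

namespace SimpleGraph

variable {V : Type*}

/-! ### Vertex recursion, Rayleigh and Wronskian inequalities. -/

/-- A family of ring elements indexed by finite vertex sets that satisfies the vertex recursion of
the (vertex-weighted) matching polynomial. -/
def IsMatchingFamily [DecidableEq V] (G : SimpleGraph V) [DecidableRel G.Adj] {R : Type*}
    [CommRing R] (z : V → R) (f : Finset V → R) : Prop :=
  ∀ A : Finset V, ∀ u ∈ A, f A = z u * f (A.erase u) -
    ∑ w ∈ (A.erase u).filter (G.Adj u), f ((A.erase u).erase w)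

section Family

variable [DecidableEq V] {G : SimpleGraph V} [DecidableRel G.Adj]

theorem IsMatchingFamily.map {R R' : Type*} [CommRing R] [CommRing R'] (φ : R →+* R')
    {z : V → R} {f : Finset V → R} (hf : G.IsMatchingFamily z f) :
    G.IsMatchingFamily (fun v => φ (z v)) (fun A => φ (f A)) := by
  intro A u hu
  simp only
  rw [hf A u hu, map_sub, map_mul, map_sum]

/-- Changing the weight of a single vertex. -/
theorem IsMatchingFamily.shift {R : Type*} [CommRing R]
    {z : V → R} {f : Finset V → R} (hf : G.IsMatchingFamily z f) (w : V) (s : R) :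
    G.IsMatchingFamily (fun v => if v = w then z v + s else z v)
      (fun A => if w ∈ A then f A + s * f (A.erase w) else f A) := by
  intro A u hu
  by_cases hw : w ∈ A
  · by_cases huw : u = w
    · subst huw
      have h1 : ∀ i, u ∉ (A.erase u).erase i := by simp
      simp only [hw, if_true, Finset.notMem_erase, if_false, h1]
      rw [hf A u hu]; ring
    · have h2 : w ∈ A.erase u := by simp [hw, Ne.symm huw]
      have h3 : u ∈ A.erase w := by simp [hu, huw]
      simp only [hw, if_true, h2, huw, if_false]
      rw [hf A u hu, hf (A.erase w) u h3]
      have key : ∑ i ∈ (A.erase u).filter (G.Adj u),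
            (if w ∈ (A.erase u).erase i then
              f ((A.erase u).erase i) + s * f (((A.erase u).erase i).erase w)
              else f ((A.erase u).erase i)) =
          ∑ i ∈ (A.erase u).filter (G.Adj u), f ((A.erase u).erase i) +
          s * ∑ i ∈ ((A.erase w).erase u).filter (G.Adj u), f (((A.erase w).erase u).erase i) := by
        have e : ((A.erase w).erase u).filter (G.Adj u) =
            ((A.erase u).filter (G.Adj u)).filter (· ≠ w) := by
          ext i; simp only [Finset.mem_filter, Finset.mem_erase]; tauto
        rw [e, Finset.sum_filter (· ≠ w), Finset.mul_sum, ← Finset.sum_add_distrib]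
        refine Finset.sum_congr rfl fun i hi => ?_
        by_cases hiw : i = w
        · subst hiw; simp
        · have : w ∈ (A.erase u).erase i := by simp [h2, Ne.symm hiw]
          simp only [this, if_true, hiw, ne_eq, not_false_eq_true]
          rw [Finset.erase_right_comm (a := i) (b := w), Finset.erase_right_comm (a := u) (b := w)]
      rw [key, Finset.erase_right_comm (a := u) (b := w)]; ring
  · have h1 : w ∉ A.erase u := by simp [hw]
    have h2 : ∀ i, w ∉ (A.erase u).erase i := by simp [hw]
    have h3 : u ≠ w := by rintro rfl; exact hw hu
    simp only [hw, if_false, h1, h2, h3]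
    exact hf A u hu

/-- The Rayleigh inequality for matching polynomials with real vertex weights. -/
theorem IsMatchingFamily.rayleigh {z : V → ℝ} {f : Finset V → ℝ} (hf : G.IsMatchingFamily z f)
    (A : Finset V) {u v : V} (hu : u ∈ A) (hv : v ∈ A) (huv : u ≠ v) :
    f A * f ((A.erase u).erase v) ≤ f (A.erase u) * f (A.erase v) := by
  induction h : A.card generalizing A u with
  | zero => simp [Finset.card_eq_zero.mp h] at hu
  | succ n ih =>
    have hv' : v ∈ A.erase u := by simp [hv, huv.symm]
    have hu' : u ∈ A.erase v := by simp [hu, huv]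
    have hc : (A.erase u).card = n := by rw [Finset.card_erase_of_mem hu, h]; rfl
    have e : ((A.erase v).erase u).filter (G.Adj u) =
        ((A.erase u).filter (G.Adj u)).filter (· ≠ v) := by
      ext i; simp only [Finset.mem_filter, Finset.mem_erase]; tauto
    rw [hf A u hu, hf (A.erase v) u hu', e, Finset.sum_filter (· ≠ v),
      Finset.erase_right_comm (a := v) (b := u)]
    -- After expanding both sides at `u` the terms with `z u` cancel. The summand `i = v` on the
    -- right is a square; every other one is the inequality for `A - u` and the pair `i`, `v`.
    have key : (∑ i ∈ (A.erase u).filter (G.Adj u),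
          (if i ≠ v then f (((A.erase u).erase v).erase i) else 0)) * f (A.erase u) ≤
        (∑ i ∈ (A.erase u).filter (G.Adj u), f ((A.erase u).erase i)) *
          f ((A.erase u).erase v) := by
      rw [Finset.sum_mul, Finset.sum_mul]
      refine Finset.sum_le_sum fun i hi => ?_
      by_cases hiv : i = v
      · subst hiv
        simpa using mul_self_nonneg _
      · simp only [ne_eq, hiv, not_false_eq_true, if_true]
        have := ih (A.erase u) (Finset.mem_of_mem_filter i hi) hv' hiv hc
        rw [Finset.erase_right_comm (a := v) (b := i)]
        linarith
    linarith

/-- Differentiating the recursion writes the Wronskian of `f A`, `f (A - u)` as `f (A - u) ^ 2` plus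
Wronskians of the same kind for `A - u`, nonnegative by induction. -/
theorem IsMatchingFamily.wronskian {θ : ℝ} {f : Finset V → ℝ[X]}
    (hf : G.IsMatchingFamily (fun _ => X + C θ) f) (A : Finset V) {u : V} (hu : u ∈ A) (x : ℝ) :
    (f (A.erase u)).eval x ^ 2 ≤
      (derivative (f A) * f (A.erase u) - f A * derivative (f (A.erase u))).eval x := by
  induction h : A.card generalizing A u with
  | zero => simp [Finset.card_eq_zero.mp h] at hu
  | succ n ih =>
    have hc : (A.erase u).card = n := by rw [Finset.card_erase_of_mem hu, h]; rfl
    have key : derivative (f A) * f (A.erase u) - f A * derivative (f (A.erase u)) =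
        f (A.erase u) ^ 2 + ∑ i ∈ (A.erase u).filter (G.Adj u),
          (derivative (f (A.erase u)) * f ((A.erase u).erase i) -
            f (A.erase u) * derivative (f ((A.erase u).erase i))) := by
      rw [Finset.sum_sub_distrib, ← Finset.mul_sum, ← Finset.mul_sum]
      conv_lhs => rw [hf A u hu]
      simp only [derivative_sub, derivative_mul, derivative_add, derivative_X, derivative_C,
        derivative_sum]
      ring
    rw [key, eval_add, eval_pow, eval_finsetSum]
    refine le_add_of_nonneg_right (Finset.sum_nonneg fun i hi => ?_)
    exact (sq_nonneg _).trans (ih (A.erase u) (Finset.mem_of_mem_filter i hi) hc)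

end Family

/-! ### Orders of vanishing at zero and signs of lowest coefficients. -/

theorem eval_zero_nonneg_of_forall_pos {n : ℕ} {s : ℝ[X]}
    (h : ∀ x : ℝ, 0 < x → 0 ≤ (X ^ n * s).eval x) : 0 ≤ s.eval 0 := by
  have h1 : Filter.Tendsto (fun x => s.eval x) (nhdsWithin 0 (Set.Ioi 0)) (nhds (s.eval 0)) :=
    (s.continuous.tendsto 0).mono_left nhdsWithin_le_nhds
  refine ge_of_tendsto h1 ?_
  filter_upwards [self_mem_nhdsWithin] with x hx
  have := h x hx
  rw [eval_mul, eval_pow, eval_X] at this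
  exact nonneg_of_mul_nonneg_right this (pow_pos hx n)

theorem exists_eq_X_pow_mul_of_ne_zero {p : ℝ[X]} (hp : p ≠ 0) :
    ∃ a : ℝ[X], p = X ^ p.natTrailingDegree * a ∧ a.eval 0 = p.trailingCoeff ∧ a.eval 0 ≠ 0 := by
  obtain ⟨a, ha⟩ := X_pow_dvd_iff.mpr
    (fun d (hd : d < p.natTrailingDegree) => coeff_eq_zero_of_lt_natTrailingDegree hd)
  have h1 : a.eval 0 = p.trailingCoeff := by
    have := congrArg (fun q => coeff q p.natTrailingDegree) ha
    simp only [coeff_X_pow_mul', le_refl, if_true, Nat.sub_self] at this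
    rw [← coeff_zero_eq_eval_zero, trailingCoeff, this]
  exact ⟨a, ha, h1, h1 ▸ trailingCoeff_nonzero_iff_nonzero.mpr hp⟩

theorem le_natTrailingDegree_of_dvd {p : ℝ[X]} (hp : p ≠ 0) {n : ℕ} (h : X ^ n ∣ p) :
    n ≤ p.natTrailingDegree :=
  le_natTrailingDegree hp fun d hd => X_pow_dvd_iff.mp h d hd

theorem X_pow_dvd_of_le_natTrailingDegree {p : ℝ[X]} {n : ℕ} (h : n ≤ p.natTrailingDegree) :
    X ^ n ∣ p :=
  X_pow_dvd_iff.mpr fun _ hd => coeff_eq_zero_of_lt_natTrailingDegree (hd.trans_le h)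

/-- The extra factor `X` avoids the exponents `k - 1` and `j - 1`, which would truncate at zero. -/
theorem X_mul_wronskian (k j : ℕ) (a b : ℝ[X]) :
    X * (derivative (X ^ k * a) * (X ^ j * b) - X ^ k * a * derivative (X ^ j * b)) =
      X ^ (k + j) * (C ((k : ℝ) - j) * (a * b) +
        X * (derivative a * b - a * derivative b)) := by
  have h : ∀ n : ℕ, X * derivative (X ^ n : ℝ[X]) = (n : ℝ[X]) * X ^ n := by
    rintro (_ | n)
    · simp
    · rw [derivative_X_pow]; simp; ring
  simp only [derivative_mul, C_sub, C_eq_natCast]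
  linear_combination a * b * X ^ j * h k - a * b * X ^ k * h j

section Order

variable [DecidableEq V] {G : SimpleGraph V} [DecidableRel G.Adj] {θ : ℝ} {f : Finset V → ℝ[X]}

/-- Otherwise, with `j` the order of `f (A - u)`, the Wronskian has order at least `2 * j + 1` and
cannot dominate `f (A - u) ^ 2`, of order `2 * j`, near `0`. -/
theorem IsMatchingFamily.le_natTrailingDegree_erase
    (hf : G.IsMatchingFamily (fun _ => X + C θ) f) (h0 : ∀ A, f A ≠ 0)
    (A : Finset V) {u : V} (hu : u ∈ A) :
    (f A).natTrailingDegree ≤ (f (A.erase u)).natTrailingDegree + 1 := by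
  by_contra! hlt
  obtain ⟨a, ha, -, -⟩ := exists_eq_X_pow_mul_of_ne_zero (h0 A)
  obtain ⟨b, hb, -, hb0⟩ := exists_eq_X_pow_mul_of_ne_zero (h0 (A.erase u))
  have hW := hf.wronskian A hu
  generalize (f (A.erase u)).natTrailingDegree = j at *
  obtain ⟨d, hd⟩ := Nat.exists_eq_add_of_le (show j + 2 ≤ _ from hlt)
  generalize (f A).natTrailingDegree = k at *
  have hX := X_mul_wronskian k j a b
  have key := eval_zero_nonneg_of_forall_pos (n := 2 * j + 1)
    (s := X ^ (d + 1) * (C ((k : ℝ) - j) * (a * b) + X * (derivative a * b - a * derivative b))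
      - b ^ 2) ?_
  · simp only [eval_sub, eval_mul, eval_pow, eval_X, pow_succ, mul_zero, zero_mul, zero_sub] at key
    have := sq_pos_of_ne_zero hb0
    simp only [pow_zero, one_mul] at key
    nlinarith
  · intro x hx
    have e : X ^ (2 * j + 1) * (X ^ (d + 1) * (C ((k : ℝ) - j) * (a * b) +
          X * (derivative a * b - a * derivative b)) - b ^ 2) =
        X * ((derivative (f A) * f (A.erase u) - f A * derivative (f (A.erase u))) -
          f (A.erase u) ^ 2) := by
      rw [ha, hb]; subst hd; linear_combination -hX
    rw [e, eval_mul, eval_X, eval_sub, eval_pow]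
    exact mul_nonneg hx.le (sub_nonneg.mpr (hW x))

/-- By the opposite bound applied to `A - u`, every term of the recursion for `f A` has order at
least that of `f (A - u)` minus one. -/
theorem IsMatchingFamily.natTrailingDegree_erase_le
    (hf : G.IsMatchingFamily (fun _ => X + C θ) f) (h0 : ∀ A, f A ≠ 0)
    (A : Finset V) {u : V} (hu : u ∈ A) :
    (f (A.erase u)).natTrailingDegree ≤ (f A).natTrailingDegree + 1 := by
  rw [← Nat.sub_le_iff_le_add]
  refine le_natTrailingDegree_of_dvd (h0 A) ?_
  rw [hf A u hu]
  refine dvd_sub (Dvd.dvd.mul_left (X_pow_dvd_of_le_natTrailingDegree (Nat.sub_le _ _)) _)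
    (Finset.dvd_sum fun i hi => X_pow_dvd_of_le_natTrailingDegree ?_)
  rw [Nat.sub_le_iff_le_add]
  exact hf.le_natTrailingDegree_erase h0 _ (Finset.mem_of_mem_filter i hi)

/-- For orders `k`, `j` and lowest coefficients `a`, `b`, the coefficient of degree `k + j` in `X`
times the Wronskian is `(k - j) * a * b`, and the Wronskian is nonnegative. -/
theorem IsMatchingFamily.trailingCoeff_sign
    (hf : G.IsMatchingFamily (fun _ => X + C θ) f) (h0 : ∀ A, f A ≠ 0)
    (A : Finset V) {u : V} (hu : u ∈ A) :
    0 ≤ (((f A).natTrailingDegree : ℝ) - (f (A.erase u)).natTrailingDegree) *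
      ((f A).trailingCoeff * (f (A.erase u)).trailingCoeff) := by
  obtain ⟨a, ha, ha0, -⟩ := exists_eq_X_pow_mul_of_ne_zero (h0 A)
  obtain ⟨b, hb, hb0, -⟩ := exists_eq_X_pow_mul_of_ne_zero (h0 (A.erase u))
  have hW := hf.wronskian A hu
  rw [← ha0, ← hb0]
  generalize (f (A.erase u)).natTrailingDegree = j at *
  generalize (f A).natTrailingDegree = k at *
  have hX := X_mul_wronskian k j a b
  have key := eval_zero_nonneg_of_forall_pos (n := k + j)
    (s := C ((k : ℝ) - j) * (a * b) + X * (derivative a * b - a * derivative b)) ?_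
  · simpa using key
  · intro x hx
    rw [← hX, eval_mul, eval_X, ← ha, ← hb]
    exact mul_nonneg hx.le ((sq_nonneg _).trans (hW x))

theorem IsMatchingFamily.trailingCoeff_mul_neg
    (hf : G.IsMatchingFamily (fun _ => X + C θ) f) (h0 : ∀ A, f A ≠ 0)
    (A : Finset V) {u : V} (hu : u ∈ A)
    (h : (f (A.erase u)).natTrailingDegree = (f A).natTrailingDegree + 1) :
    (f A).trailingCoeff * (f (A.erase u)).trailingCoeff < 0 := by
  have h1 := hf.trailingCoeff_sign h0 A hu
  rw [h] at h1
  push_cast at h1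
  refine lt_of_le_of_ne (by linarith) (mul_ne_zero ?_ ?_) <;>
    exact trailingCoeff_nonzero_iff_nonzero.mpr (h0 _)

theorem IsMatchingFamily.trailingCoeff_mul_pos
    (hf : G.IsMatchingFamily (fun _ => X + C θ) f) (h0 : ∀ A, f A ≠ 0)
    (A : Finset V) {u : V} (hu : u ∈ A)
    (h : (f A).natTrailingDegree = (f (A.erase u)).natTrailingDegree + 1) :
    0 < (f A).trailingCoeff * (f (A.erase u)).trailingCoeff := by
  have h1 := hf.trailingCoeff_sign h0 A hu
  rw [h] at h1
  push_cast at h1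
  refine lt_of_le_of_ne (by linarith) (mul_ne_zero ?_ ?_).symm <;>
    exact trailingCoeff_nonzero_iff_nonzero.mpr (h0 _)

/-- If all six proper nonempty subsets `S` of `{u, v, w}` raise the order of vanishing by `|S|`,
then so does `{u, v, w}`. -/
theorem IsMatchingFamily.natTrailingDegree_erase_three
    (hf : G.IsMatchingFamily (fun _ => X + C θ) f) (h0 : ∀ A, f A ≠ 0)
    (A : Finset V) {u v w : V} {k : ℕ} (hu : u ∈ A) (hv : v ∈ A) (hw : w ∈ A)
    (huv : u ≠ v) (huw : u ≠ w) (hvw : v ≠ w) (hk : (f A).natTrailingDegree = k)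
    (h1u : (f (A.erase u)).natTrailingDegree = k + 1)
    (h1v : (f (A.erase v)).natTrailingDegree = k + 1)
    (h1w : (f (A.erase w)).natTrailingDegree = k + 1)
    (h2uv : (f ((A.erase u).erase v)).natTrailingDegree = k + 2)
    (h2uw : (f ((A.erase u).erase w)).natTrailingDegree = k + 2)
    (h2vw : (f ((A.erase v).erase w)).natTrailingDegree = k + 2) :
    (f (((A.erase u).erase v).erase w)).natTrailingDegree = k + 3 := by
  have hw' : w ∈ (A.erase u).erase v := by simp [hw, huw.symm, hvw.symm]
  have hle := hf.natTrailingDegree_erase_le h0 _ hw'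
  have hge := hf.le_natTrailingDegree_erase h0 _ hw'
  -- Rayleigh with the weight of `w` raised by `s`: a quadratic in `s` that is nonnegative for every
  -- real `s`, so its discriminant is at most zero.
  have ray : ∀ x s : ℝ,
      ((f A).eval x + s * (f (A.erase w)).eval x) *
        ((f ((A.erase u).erase v)).eval x + s * (f (((A.erase u).erase v).erase w)).eval x) ≤
      ((f (A.erase u)).eval x + s * (f ((A.erase u).erase w)).eval x) *
        ((f (A.erase v)).eval x + s * (f ((A.erase v).erase w)).eval x) := by
    intro x s
    have := ((hf.map (evalRingHom x)).shift w s).rayleigh A hu hv huv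
    simpa [hw, huw.symm, hvw.symm] using this
  obtain ⟨a, ha, -, ha0⟩ := exists_eq_X_pow_mul_of_ne_zero (h0 A)
  obtain ⟨au, hau, -, -⟩ := exists_eq_X_pow_mul_of_ne_zero (h0 (A.erase u))
  obtain ⟨av, hav, -, -⟩ := exists_eq_X_pow_mul_of_ne_zero (h0 (A.erase v))
  obtain ⟨aw, haw, -, -⟩ := exists_eq_X_pow_mul_of_ne_zero (h0 (A.erase w))
  obtain ⟨auv, hauv, -, -⟩ := exists_eq_X_pow_mul_of_ne_zero (h0 ((A.erase u).erase v))
  obtain ⟨auw, hauw, -, -⟩ := exists_eq_X_pow_mul_of_ne_zero (h0 ((A.erase u).erase w))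
  obtain ⟨avw, havw, -, -⟩ := exists_eq_X_pow_mul_of_ne_zero (h0 ((A.erase v).erase w))
  obtain ⟨g, hg, -, hg0⟩ := exists_eq_X_pow_mul_of_ne_zero (h0 (((A.erase u).erase v).erase w))
  rw [h2uv] at hle hge hauv
  rw [hk] at ha
  rw [h1u] at hau
  rw [h1v] at hav
  rw [h1w] at haw
  rw [h2uw] at hauw
  rw [h2vw] at havw
  generalize f A = F at *
  generalize f (A.erase u) = Fu at *
  generalize f (A.erase v) = Fv at *
  generalize f (A.erase w) = Fw at *
  generalize f ((A.erase u).erase w) = Fuw at *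
  generalize f ((A.erase v).erase w) = Fvw at *
  generalize f (((A.erase u).erase v).erase w) = Fuvw at *
  generalize f ((A.erase u).erase v) = Fuv at *
  have disc : ∀ x : ℝ, 0 ≤ (4 * (Fuw * Fvw - Fw * Fuvw) * (Fu * Fv - F * Fuv) -
      (Fu * Fvw + Fuw * Fv - F * Fuvw - Fw * Fuv) ^ 2).eval x := by
    intro x
    have := discrim_le_zero (a := (Fuw * Fvw - Fw * Fuvw).eval x)
      (b := (Fu * Fvw + Fuw * Fv - F * Fuvw - Fw * Fuv).eval x)
      (c := (Fu * Fv - F * Fuv).eval x) (fun s => by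
        have := ray x s
        simp only [eval_add, eval_sub, eval_mul]
        linarith)
    rw [discrim] at this
    simp only [eval_add, eval_sub, eval_mul, eval_pow, eval_ofNat] at this ⊢
    linarith
  have hcases : Fuvw.natTrailingDegree = k + 1 ∨ Fuvw.natTrailingDegree = k + 2 ∨
      Fuvw.natTrailingDegree = k + 3 := by omega
  rcases hcases with h | h | h
  -- The square has lowest term `(a * g) ^ 2` in degree `4 * k + 2`, from `F * Fuvw`, while the
  -- product in `disc` has order at least `4 * k + 4`.
  · rw [h] at hg
    have key := eval_zero_nonneg_of_forall_pos (n := 4 * k + 2)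
      (s := 4 * X ^ 2 * (X ^ 2 * auw * avw - aw * g) * (au * av - a * auv) -
        (X ^ 2 * au * avw + X ^ 2 * auw * av - a * g - X ^ 2 * aw * auv) ^ 2)
      (fun x _ => by
        convert disc x using 2
        rw [ha, hau, hav, haw, hauv, hauw, havw, hg]
        ring)
    simp [ha0, hg0] at key
  -- Now the square starts in degree `4 * k + 4` and the product in degree at least `4 * k + 5`.
  · rw [h] at hg
    have key := eval_zero_nonneg_of_forall_pos (n := 4 * k + 4)
      (s := 4 * X * (X * auw * avw - aw * g) * (au * av - a * auv) -
        (X * au * avw + X * auw * av - a * g - X * aw * auv) ^ 2)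
      (fun x _ => by
        convert disc x using 2
        rw [ha, hau, hav, haw, hauv, hauw, havw, hg]
        ring)
    simp [ha0, hg0] at key
  · exact h

end Order

/-! ### Deletions from a nice set and the construction of the matching. -/

theorem pos_mul_trans {s a b c : ℝ} (h1 : 0 < s * (a * b)) (h2 : 0 < b * c) : 0 < s * (a * c) := by
  have hb : b ≠ 0 := by rintro rfl; simp at h2
  have h3 : 0 < s * (a * c) * b ^ 2 := by
    have := mul_pos h1 h2
    linarith [show s * (a * b) * (b * c) = s * (a * c) * b ^ 2 by ring]
  exact pos_of_mul_pos_left h3 (sq_nonneg b)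

/-- Deleting one or two elements of `X` from `A` raises the order of vanishing of `f` at `0`
by the number of deleted elements. -/
structure IsRaising [DecidableEq V] (f : Finset V → ℝ[X]) (A X : Finset V) (k : ℕ) : Prop where
  subset : X ⊆ A
  zero : (f A).natTrailingDegree = k
  one : ∀ u ∈ X, (f (A.erase u)).natTrailingDegree = k + 1
  two : ∀ u ∈ X, ∀ v ∈ X, u ≠ v → (f ((A.erase u).erase v)).natTrailingDegree = k + 2

/-- A matching of the vertices `x i` with vertices `y i` outside `X` whose removal keeps the
order of vanishing. -/
structure IsGoodMatching [DecidableEq V] {ι : Type*} (G : SimpleGraph V) (f : Finset V → ℝ[X]) (A X : Finset V)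
    (k : ℕ) (x y : ι → V) (I : Finset ι) : Prop where
  adj : ∀ i ∈ I, G.Adj (x i) (y i)
  mem : ∀ i ∈ I, y i ∈ A
  notMem : ∀ i ∈ I, y i ∉ X
  injOn : Set.InjOn y I
  order : (f ((A \ I.image x) \ I.image y)).natTrailingDegree = k

section GoodMatching

variable [DecidableEq V] {G : SimpleGraph V} {f : Finset V → ℝ[X]} {ι : Type*} {A X : Finset V}
  {k : ℕ} {x y : ι → V}

theorem IsGoodMatching.image_subset {I : Finset ι} (hI : IsGoodMatching G f A X k x y I) :
    I.image y ⊆ A := by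
  intro v hv
  obtain ⟨i, hi, rfl⟩ := Finset.mem_image.mp hv
  exact hI.mem i hi

theorem IsGoodMatching.disjoint {I : Finset ι} (hI : IsGoodMatching G f A X k x y I) :
    Disjoint (I.image y) X := by
  refine Finset.disjoint_left.mpr fun v hv => ?_
  obtain ⟨i, hi, rfl⟩ := Finset.mem_image.mp hv
  exact hI.notMem i hi

end GoodMatching

section Raising

variable [DecidableEq V] {G : SimpleGraph V} [DecidableRel G.Adj] {θ : ℝ} {f : Finset V → ℝ[X]}

/-- The field `two` for the smaller set is the three-vertex statement for the original one. -/
theorem IsRaising.erase (hf : G.IsMatchingFamily (fun _ => X + C θ) f) (h0 : ∀ A, f A ≠ 0)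
    {A X : Finset V} {k : ℕ} (h : IsRaising f A X k) {x : V} (hx : x ∈ X) :
    IsRaising f (A.erase x) (X.erase x) (k + 1) where
  subset := Finset.erase_subset_erase x h.subset
  zero := h.one x hx
  one u hu := h.two x hx u (Finset.mem_of_mem_erase hu) (Finset.ne_of_mem_erase hu).symm
  two u hu v hv huv := by
    have hu1 := Finset.mem_of_mem_erase hu
    have hv1 := Finset.mem_of_mem_erase hv
    have hxu := (Finset.ne_of_mem_erase hu).symm
    have hxv := (Finset.ne_of_mem_erase hv).symm
    exact hf.natTrailingDegree_erase_three h0 A (h.subset hx) (h.subset hu1) (h.subset hv1)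
      hxu hxv huv h.zero (h.one x hx) (h.one u hu1) (h.one v hv1) (h.two x hx u hu1 hxu)
      (h.two x hx v hv1 hxv) (h.two u hu1 v hv1 huv)

theorem IsRaising.sdiff (hf : G.IsMatchingFamily (fun _ => X + C θ) f) (h0 : ∀ A, f A ≠ 0)
    {A X : Finset V} {k : ℕ} (h : IsRaising f A X k) (S : Finset V) (hS : S ⊆ X) :
    IsRaising f (A \ S) (X \ S) (k + S.card) ∧
      0 < (-1 : ℝ) ^ S.card * ((f A).trailingCoeff * (f (A \ S)).trailingCoeff) := by
  induction S using Finset.induction_on with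
  | empty =>
    refine ⟨by simpa using h, ?_⟩
    simpa using mul_self_pos.mpr (trailingCoeff_nonzero_iff_nonzero.mpr (h0 A))
  | insert x S hx ih =>
    obtain ⟨h1, h2⟩ := ih ((Finset.subset_insert x S).trans hS)
    have hxX : x ∈ X \ S := Finset.mem_sdiff.mpr ⟨hS (Finset.mem_insert_self x S), hx⟩
    rw [Finset.sdiff_insert, Finset.sdiff_insert, Finset.card_insert_of_notMem hx, ← add_assoc]
    refine ⟨h1.erase hf h0 hxX, ?_⟩
    have h3 := hf.trailingCoeff_mul_neg h0 (A \ S) (h1.subset hxX)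
      ((h1.one x hxX).trans (by rw [h1.zero]))
    have := pos_mul_trans (c := -(f ((A \ S).erase x)).trailingCoeff) h2 (by linarith)
    rw [pow_succ]
    linarith

/-- Each vertex of `T` lowers the order by at most one. Equality forces a drop at every deletion,
and a drop preserves the sign of the lowest coefficient. -/
theorem IsRaising.le_natTrailingDegree_sdiff_sdiff
    (hf : G.IsMatchingFamily (fun _ => X + C θ) f) (h0 : ∀ A, f A ≠ 0)
    {A X : Finset V} {k : ℕ} (h : IsRaising f A X k) {S : Finset V} (hS : S ⊆ X)
    (T : Finset V) (hT : T ⊆ A \ S) :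
    k + S.card ≤ (f ((A \ S) \ T)).natTrailingDegree + T.card ∧
      (k + S.card = (f ((A \ S) \ T)).natTrailingDegree + T.card →
        0 < (-1 : ℝ) ^ S.card * ((f A).trailingCoeff * (f ((A \ S) \ T)).trailingCoeff)) := by
  obtain ⟨h1, h2⟩ := h.sdiff hf h0 S hS
  induction T using Finset.induction_on with
  | empty => simpa [h1.zero] using h2
  | insert u T hu ih =>
    obtain ⟨h3, h4⟩ := ih ((Finset.subset_insert u T).trans hT)
    have hu' : u ∈ (A \ S) \ T := Finset.mem_sdiff.mpr ⟨hT (Finset.mem_insert_self u T), hu⟩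
    have h5 := hf.le_natTrailingDegree_erase h0 _ hu'
    rw [Finset.sdiff_insert, Finset.card_insert_of_notMem hu]
    refine ⟨by omega, fun h6 => ?_⟩
    exact pos_mul_trans (h4 (by omega)) (hf.trailingCoeff_mul_pos h0 _ hu' (by omega))

/-- Here `n` is the least possible order, so the coefficient is either zero or the lowest one. -/
theorem IsRaising.coeff_sign
    (hf : G.IsMatchingFamily (fun _ => X + C θ) f) (h0 : ∀ A, f A ≠ 0)
    {A X : Finset V} {k : ℕ} (h : IsRaising f A X k) {S : Finset V} (hS : S ⊆ X)
    (T : Finset V) (hT : T ⊆ A \ S) {n : ℕ} (hn : n + T.card = k + S.card) :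
    0 ≤ (-1 : ℝ) ^ S.card * ((f A).trailingCoeff * (f ((A \ S) \ T)).coeff n) ∧
      ((f ((A \ S) \ T)).natTrailingDegree = n →
        0 < (-1 : ℝ) ^ S.card * ((f A).trailingCoeff * (f ((A \ S) \ T)).coeff n)) := by
  obtain ⟨h1, h2⟩ := h.le_natTrailingDegree_sdiff_sdiff hf h0 hS T hT
  have h3 : (f ((A \ S) \ T)).natTrailingDegree = n →
        0 < (-1 : ℝ) ^ S.card * ((f A).trailingCoeff * (f ((A \ S) \ T)).coeff n) := by
    intro h4
    have := h2 (by omega)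
    rwa [trailingCoeff.eq_def (f ((A \ S) \ T)), h4] at this
  refine ⟨?_, h3⟩
  by_cases h4 : (f ((A \ S) \ T)).natTrailingDegree = n
  · exact (h3 h4).le
  · rw [coeff_eq_zero_of_lt_natTrailingDegree (by omega)]; simp

theorem IsMatchingFamily.coeff_eq (hf : G.IsMatchingFamily (fun _ => X + C θ) f)
    {B : Finset V} {u : V} (hu : u ∈ B) {n : ℕ}
    (h1 : n + 1 ≤ (f (B.erase u)).natTrailingDegree) :
    (f B).coeff n = -∑ w ∈ (B.erase u).filter (G.Adj u), (f ((B.erase u).erase w)).coeff n := by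
  have : ((X + C θ) * f (B.erase u)).coeff n = 0 :=
    X_pow_dvd_iff.mp (Dvd.dvd.mul_left (X_pow_dvd_of_le_natTrailingDegree h1) _) n (Nat.lt_succ_self n)
  rw [hf B u hu, coeff_sub, this, finsetSum_coeff, zero_sub]

/-- No cancellation: coefficient `n` of `f B` is minus a sum of terms of one sign, one of them
nonzero. -/
theorem IsMatchingFamily.natTrailingDegree_le_of_sign
    (hf : G.IsMatchingFamily (fun _ => X + C θ) f)
    {B : Finset V} {u : V} (hu : u ∈ B) {n : ℕ} (σ : ℝ)
    (h1 : n + 1 ≤ (f (B.erase u)).natTrailingDegree)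
    (h2 : ∀ w ∈ B.erase u, 0 ≤ σ * (f ((B.erase u).erase w)).coeff n)
    (h3 : ∃ w ∈ B.erase u, G.Adj u w ∧ 0 < σ * (f ((B.erase u).erase w)).coeff n) :
    (f B).natTrailingDegree ≤ n := by
  refine natTrailingDegree_le_of_ne_zero fun h4 => ?_
  rw [hf.coeff_eq hu h1, neg_eq_zero] at h4
  obtain ⟨w, hw, hadj, hpos⟩ := h3
  have : 0 < ∑ w ∈ (B.erase u).filter (G.Adj u), σ * (f ((B.erase u).erase w)).coeff n :=
    Finset.sum_pos' (fun i hi => h2 i (Finset.mem_of_mem_filter i hi))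
      ⟨w, Finset.mem_filter.mpr ⟨hw, hadj⟩, hpos⟩
  rw [← Finset.mul_sum, h4, mul_zero] at this
  exact lt_irrefl _ this

theorem sdiff_sdiff_erase_erase (A S T : Finset V) (x w : V) :
    (((A \ S) \ T).erase x).erase w = (A \ insert x S) \ insert w T := by
  ext v; simp only [Finset.mem_erase, Finset.mem_sdiff, Finset.mem_insert]; tauto

theorem sdiff_sdiff_erase (A S T : Finset V) (x : V) :
    ((A \ S) \ T).erase x = (A \ insert x S) \ T := by
  ext v; simp only [Finset.mem_erase, Finset.mem_sdiff, Finset.mem_insert]; tauto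

/-- Deleting `x` as well gives order at least `k + 1`, so the nonzero coefficient of degree `k` must
come from a neighbour term of the recursion at `x`. -/
theorem IsRaising.exists_adj
    (hf : G.IsMatchingFamily (fun _ => X + C θ) f) (h0 : ∀ A, f A ≠ 0)
    {A X : Finset V} {k : ℕ} (h : IsRaising f A X k) {S T : Finset V} (hS : S ⊆ X)
    (hT : T ⊆ A) (hTX : Disjoint T X) (hc : S.card = T.card)
    (hk : (f ((A \ S) \ T)).natTrailingDegree = k) {x : V} (hx : x ∈ X) (hxS : x ∉ S) :
    ∃ w ∈ (A \ S) \ T, w ∉ X ∧ G.Adj x w ∧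
      (f ((A \ insert x S) \ insert w T)).natTrailingDegree = k := by
  have hxT : x ∉ T := fun hx' => Finset.disjoint_left.mp hTX hx' hx
  have hxB : x ∈ (A \ S) \ T := by simp [h.subset hx, hxS, hxT]
  have hxS' : insert x S ⊆ X := Finset.insert_subset hx hS
  have hTS : T ⊆ A \ insert x S := fun t ht => Finset.mem_sdiff.mpr
    ⟨hT ht, fun h' => Finset.disjoint_left.mp hTX ht (hxS' h')⟩
  have h1 := (h.le_natTrailingDegree_sdiff_sdiff hf h0 hxS' T hTS).1
  rw [Finset.card_insert_of_notMem hxS] at h1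
  have h2 := hf.coeff_eq hxB (n := k) (by rw [sdiff_sdiff_erase]; omega)
  have h3 : (f ((A \ S) \ T)).coeff k ≠ 0 := by
    rw [← hk]; exact trailingCoeff_nonzero_iff_nonzero.mpr (h0 _)
  rw [h2, neg_ne_zero] at h3
  obtain ⟨w, hw, hw0⟩ := Finset.exists_ne_zero_of_sum_ne_zero h3
  obtain ⟨hwB, hadj⟩ := Finset.mem_filter.mp hw
  have hle := natTrailingDegree_le_of_ne_zero hw0
  rw [sdiff_sdiff_erase_erase] at hle
  have hwx : w ≠ x := Finset.ne_of_mem_erase hwB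
  have hwB' := Finset.mem_of_mem_erase hwB
  have hwA : w ∈ A ∧ w ∉ S ∧ w ∉ T := by
    simpa [and_assoc] using hwB'
  have hwT : insert w T ⊆ A \ insert x S :=
    Finset.insert_subset (by simp [hwA, hwx]) hTS
  have h4 := (h.le_natTrailingDegree_sdiff_sdiff hf h0 hxS' _ hwT).1
  rw [Finset.card_insert_of_notMem hxS, Finset.card_insert_of_notMem hwA.2.2] at h4
  refine ⟨w, hwB', fun hwX => ?_, hadj, by omega⟩
  -- If `w` were in `X`, two vertices of `X` would have been added to `S`, giving order at least `k
  -- + 2`.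
  have h5 := (h.le_natTrailingDegree_sdiff_sdiff hf h0
    (Finset.insert_subset hwX hxS') T (fun t ht => Finset.mem_sdiff.mpr
      ⟨hT ht, fun h' => Finset.disjoint_left.mp hTX ht (Finset.insert_subset hwX hxS' h')⟩)).1
  rw [Finset.card_insert_of_notMem (by simp [hwx, hwA]), Finset.card_insert_of_notMem hxS] at h5
  have e : (A \ insert x S) \ insert w T = (A \ insert w (insert x S)) \ T := by
    rw [← sdiff_sdiff_erase_erase, sdiff_sdiff_erase, sdiff_sdiff_erase]
  rw [e] at hle
  omega

variable {ι : Type*} {A X : Finset V} {k : ℕ} {x y : ι → V}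

theorem IsRaising.exists_isGoodMatching [DecidableEq ι]
    (hf : G.IsMatchingFamily (fun _ => Polynomial.X + C θ) f) (h0 : ∀ A, f A ≠ 0)
    (h : IsRaising f A X k) (hx : Function.Injective x) (hX : ∀ i, x i ∈ X) (I : Finset ι) :
    ∃ y : ι → V, IsGoodMatching G f A X k x y I := by
  induction I using Finset.induction_on with
  | empty => exact ⟨x, by simp, by simp, by simp, by simp, by simpa using h.zero⟩
  | insert j I hj ih =>
    obtain ⟨y, hy⟩ := ih
    have hS : I.image x ⊆ X := by
      intro v hv
      obtain ⟨i, -, rfl⟩ := Finset.mem_image.mp hv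
      exact hX i
    have hxj : x j ∉ I.image x := by simpa [hx.eq_iff] using hj
    obtain ⟨w, hw, hwX, hadj, hord⟩ := h.exists_adj hf h0 hS hy.image_subset hy.disjoint
      (by rw [Finset.card_image_of_injective _ hx, Finset.card_image_of_injOn hy.injOn])
      hy.order (hX j) hxj
    obtain ⟨⟨hwA, -⟩, hwT⟩ : (w ∈ A ∧ w ∉ I.image x) ∧ w ∉ I.image y := by
      simpa only [Finset.mem_sdiff] using hw
    have hne : ∀ i ∈ I, Function.update y j w i = y i := fun i hi =>
      Function.update_of_ne (by rintro rfl; exact hj hi) _ _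
    have himg : I.image (Function.update y j w) = I.image y := Finset.image_congr hne
    refine ⟨Function.update y j w, ?_, ?_, ?_, ?_, ?_⟩
    · intro i hi
      rcases Finset.mem_insert.mp hi with rfl | hi
      · simpa using hadj
      · rw [hne i hi]; exact hy.adj i hi
    · intro i hi
      rcases Finset.mem_insert.mp hi with rfl | hi
      · simpa using hwA
      · rw [hne i hi]; exact hy.mem i hi
    · intro i hi
      rcases Finset.mem_insert.mp hi with rfl | hi
      · simpa using hwX
      · rw [hne i hi]; exact hy.notMem i hi
    · rw [Finset.coe_insert, Set.injOn_insert (by simpa using hj)]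
      refine ⟨hy.injOn.congr fun i hi => (hne i hi).symm, ?_⟩
      rw [← Finset.coe_image, himg]
      simpa using hwT
    · rw [Finset.image_insert, Finset.image_insert, himg]
      simpa using hord

/-- In the recursion at `x j` the term of `y j` has a nonzero coefficient of degree `k`, and no
other term can cancel it. -/
theorem IsGoodMatching.of_insert [DecidableEq ι]
    (hf : G.IsMatchingFamily (fun _ => Polynomial.X + C θ) f) (h0 : ∀ A, f A ≠ 0)
    (h : IsRaising f A X k) (hx : Function.Injective x) (hX : ∀ i, x i ∈ X) {I : Finset ι} {j : ι}
    (hI : IsGoodMatching G f A X k x y (insert j I)) :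
    IsGoodMatching G f A X k x y I := by
  by_cases hj : j ∈ I
  · rwa [Finset.insert_eq_self.mpr hj] at hI
  have hsub : ∀ J : Finset ι, J.image x ⊆ X := by
    intro J v hv
    obtain ⟨i, -, rfl⟩ := Finset.mem_image.mp hv
    exact hX i
  have hinj : Set.InjOn y I := hI.injOn.mono (by simp)
  have hTA : I.image y ⊆ A := (Finset.image_subset_image (Finset.subset_insert j I)).trans
    hI.image_subset
  have hdisj : ∀ v ∈ I.image y, v ∉ X := fun v hv => Finset.disjoint_left.mp hI.disjoint
    (Finset.image_subset_image (Finset.subset_insert j I) hv)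
  refine ⟨fun i hi => hI.adj i (Finset.mem_insert_of_mem hi),
    fun i hi => hI.mem i (Finset.mem_insert_of_mem hi),
    fun i hi => hI.notMem i (Finset.mem_insert_of_mem hi), hinj, ?_⟩
  have hcard : (I.image x).card = (I.image y).card := by
    rw [Finset.card_image_of_injective _ hx, Finset.card_image_of_injOn hinj]
  have hge := (h.le_natTrailingDegree_sdiff_sdiff hf h0 (hsub I) (I.image y)
    (fun t ht => Finset.mem_sdiff.mpr ⟨hTA ht, fun h' => hdisj t ht (hsub I h')⟩)).1
  refine le_antisymm ?_ (by omega)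
  have hxj : x j ∉ I.image x := by simpa [hx.eq_iff] using hj
  have hxj' : x j ∉ I.image y := fun h' => hdisj _ h' (hX j)
  have hyj : y j ∉ I.image y := by
    intro h'
    obtain ⟨i, hi, hij⟩ := Finset.mem_image.mp h'
    have := hI.injOn (by simp [hi]) (by simp) hij
    exact hj (this ▸ hi)
  have hyA := hI.mem j (Finset.mem_insert_self j I)
  have hyX := hI.notMem j (Finset.mem_insert_self j I)
  have hyjx : y j ∉ I.image x := fun h' => hyX (hsub I h')
  have hne : y j ≠ x j := fun h' => hyX (h' ▸ hX j)
  have hTS : I.image y ⊆ A \ (insert j I).image x := fun t ht => Finset.mem_sdiff.mpr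
    ⟨hTA ht, fun h' => hdisj t ht (hsub _ h')⟩
  have hcx : ((insert j I).image x).card = (I.image x).card + 1 := by
    rw [Finset.image_insert, Finset.card_insert_of_notMem hxj]
  have hsign : ∀ w ∈ ((A \ I.image x) \ I.image y).erase (x j), _ :=
    fun w hw => h.coeff_sign hf h0 (hsub (insert j I)) (insert w (I.image y)) (n := k)
      (Finset.insert_subset (by
        simp only [Finset.mem_erase, Finset.mem_sdiff] at hw
        simp only [Finset.image_insert, Finset.mem_sdiff, Finset.mem_insert]
        tauto) hTS) (by
        simp only [Finset.mem_erase, Finset.mem_sdiff] at hw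
        rw [Finset.card_insert_of_notMem (by tauto), hcx]; omega)
  have hyB : y j ∈ ((A \ I.image x) \ I.image y).erase (x j) := by
    simp only [Finset.mem_erase, Finset.mem_sdiff]; tauto
  refine hf.natTrailingDegree_le_of_sign (u := x j)
    (by simp only [Finset.mem_sdiff]; exact ⟨⟨h.subset (hX j), hxj⟩, hxj'⟩)
    ((-1 : ℝ) ^ ((insert j I).image x).card * (f A).trailingCoeff) ?_ (fun w hw => ?_)
    ⟨y j, hyB, hI.adj j (Finset.mem_insert_self j I), ?_⟩
  · have := (h.le_natTrailingDegree_sdiff_sdiff hf h0 (hsub (insert j I)) (I.image y) hTS).1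
    rw [sdiff_sdiff_erase, ← Finset.image_insert]
    omega
  · have := (hsign w hw).1
    rw [sdiff_sdiff_erase_erase, ← Finset.image_insert]
    rwa [mul_assoc]
  · have := (hsign _ hyB).2 (by rw [← Finset.image_insert]; exact hI.order)
    rw [sdiff_sdiff_erase_erase, ← Finset.image_insert x]
    rwa [mul_assoc]

theorem IsGoodMatching.mono [DecidableEq ι]
    (hf : G.IsMatchingFamily (fun _ => Polynomial.X + C θ) f) (h0 : ∀ A, f A ≠ 0)
    (h : IsRaising f A X k) (hx : Function.Injective x) (hX : ∀ i, x i ∈ X) {I J : Finset ι}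
    (hI : IsGoodMatching G f A X k x y I) (hJ : J ⊆ I) : IsGoodMatching G f A X k x y J := by
  have key : ∀ D : Finset ι, IsGoodMatching G f A X k x y (D ∪ J) →
      IsGoodMatching G f A X k x y J := by
    intro D
    induction D using Finset.induction_on with
    | empty => simp
    | insert j D _ ih =>
      intro hD
      rw [Finset.insert_union] at hD
      exact ih (hD.of_insert hf h0 h hx hX)
  exact key I (by rwa [Finset.union_eq_left.mpr hJ])

theorem IsGoodMatching.not_adj [DecidableEq ι]
    (hf : G.IsMatchingFamily (fun _ => Polynomial.X + C θ) f) (h0 : ∀ A, f A ≠ 0)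
    (h : IsRaising f A X k) (hx : Function.Injective x) (hX : ∀ i, x i ∈ X) {I : Finset ι}
    (hI : IsGoodMatching G f A X k x y I) {i j : ι} (hi : i ∈ I) (hj : j ∈ I) (hij : i ≠ j) :
    ¬ G.Adj (y i) (y j) := by
  intro hadj
  have hP := hI.mono hf h0 h hx hX (J := {i, j}) (Finset.insert_subset hi (by simpa using hj))
  have hyi := hI.notMem i hi
  have hyj := hI.notMem j hj
  have hSX : {x i, x j} ⊆ X := Finset.insert_subset (hX i) (by simpa using hX j)
  have hcS : ({x i, x j} : Finset V).card = 2 := Finset.card_pair (hx.ne hij)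
  have hord := (h.sdiff hf h0 {x i, x j} hSX).1.zero
  have hin : ∀ v ∈ A, v ∉ X → v ∈ A \ {x i, x j} := fun v hv hvX =>
    Finset.mem_sdiff.mpr ⟨hv, fun h' => hvX (hSX h')⟩
  have hyiB := hin _ (hI.mem i hi) hyi
  have hyjB := hin _ (hI.mem j hj) hyj
  have hsign : ∀ w ∈ (A \ {x i, x j}).erase (y i), _ :=
    fun w hw => h.coeff_sign hf h0 hSX {y i, w} (n := k)
      (Finset.insert_subset hyiB (by simpa using Finset.mem_of_mem_erase hw))
      (by rw [Finset.card_pair (Finset.ne_of_mem_erase hw).symm, hcS])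
  have e : ∀ w, ((A \ {x i, x j}).erase (y i)).erase w = (A \ {x i, x j}) \ {y i, w} := by
    intro w; ext v
    simp only [Finset.mem_erase, Finset.mem_sdiff, Finset.mem_insert, Finset.mem_singleton]; tauto
  have hyjB' : y j ∈ (A \ {x i, x j}).erase (y i) := Finset.mem_erase.mpr ⟨hadj.ne', hyjB⟩
  -- Only `x i` and `x j` are deleted, so the order is `k + 2`. An edge between `y i` and `y j`
  -- would put a nonzero, uncancelled term of degree `k` into the recursion at `y i`.
  have hle := hf.natTrailingDegree_le_of_sign hyiB (n := k)
    ((-1 : ℝ) ^ ({x i, x j} : Finset V).card * (f A).trailingCoeff) ?_ (fun w hw => ?_)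
    ⟨y j, hyjB', hadj, ?_⟩
  · omega
  · have := hf.le_natTrailingDegree_erase h0 _ hyiB
    omega
  · rw [e, mul_assoc]; exact (hsign w hw).1
  · rw [e, mul_assoc]; exact (hsign _ hyjB').2 (by simpa using hP.order)

/-- Deleting two further elements of `X` after a good matching raises the order by two. -/
theorem IsGoodMatching.order_erase_erase [DecidableEq ι]
    (hf : G.IsMatchingFamily (fun _ => Polynomial.X + C θ) f) (h0 : ∀ A, f A ≠ 0)
    (h : IsRaising f A X k) (hx : Function.Injective x) (hX : ∀ i, x i ∈ X) {I : Finset ι}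
    (hI : IsGoodMatching G f A X k x y I) {u v : V} (hu : u ∈ X) (hv : v ∈ X) (huv : u ≠ v)
    (huI : u ∉ I.image x) (hvI : v ∉ I.image x) :
    (f ((((A \ I.image x) \ I.image y).erase u).erase v)).natTrailingDegree = k + 2 := by
  have hT : ∀ w ∈ X, w ∉ I.image y := fun w hw h' => Finset.disjoint_left.mp hI.disjoint h' hw
  have huB : u ∈ (A \ I.image x) \ I.image y := by
    simp only [Finset.mem_sdiff]; exact ⟨⟨h.subset hu, huI⟩, hT u hu⟩
  have hvB : v ∈ ((A \ I.image x) \ I.image y).erase u := by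
    simp only [Finset.mem_erase, Finset.mem_sdiff]
    exact ⟨huv.symm, ⟨h.subset hv, hvI⟩, hT v hv⟩
  have h1 := hf.natTrailingDegree_erase_le h0 _ huB
  have h2 := hf.natTrailingDegree_erase_le h0 _ hvB
  rw [hI.order] at h1
  have hS : insert v (insert u (I.image x)) ⊆ X := by
    refine Finset.insert_subset hv (Finset.insert_subset hu fun w hw => ?_)
    obtain ⟨i, -, rfl⟩ := Finset.mem_image.mp hw
    exact hX i
  have h3 := (h.le_natTrailingDegree_sdiff_sdiff hf h0 hS (I.image y)
    (fun t ht => Finset.mem_sdiff.mpr ⟨hI.image_subset ht, fun h' => hT t (hS h') ht⟩)).1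
  rw [Finset.card_insert_of_notMem (by simp [huv.symm, hvI]), Finset.card_insert_of_notMem huI,
    Finset.card_image_of_injective _ hx, Finset.card_image_of_injOn hI.injOn,
    ← sdiff_sdiff_erase, ← sdiff_sdiff_erase] at h3
  omega

end Raising

/-! ### Counting matchings inside vertex subsets. -/

/-- The matchings of `G` with `r` edges all of whose end points lie in `A`. -/
def matchingsIn (G : SimpleGraph V) (A : Set V) (r : ℕ) : Set (Set (Sym2 V)) :=
  {M | G.IsEdgeMatching M ∧ coveredVerts M ⊆ A ∧ M.ncard = r}

/-- Moves counts from (nested) subtypes to subsets of one vertex type, where the recursion lives. -/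
theorem numMatchings_eq_ncard_matchingsIn {W : Type*} {H : SimpleGraph W} {G : SimpleGraph V}
    (φ : H ↪g G) (r : ℕ) : H.numMatchings r = (G.matchingsIn (Set.range φ) r).ncard := by
  have hinj : Function.Injective (Sym2.map φ) := Sym2.map.injective φ.injective
  have himg : Function.Injective (fun M : Set (Sym2 W) => Sym2.map φ '' M) :=
    Set.image_injective.mpr hinj
  rw [numMatchings, ← Set.ncard_image_of_injective _ himg]
  congr 1
  ext M
  constructor
  · rintro ⟨M, ⟨⟨hM, hdisj⟩, hr⟩, rfl⟩
    refine ⟨⟨?_, ?_⟩, ?_, ?_⟩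
    · rintro _ ⟨e, he, rfl⟩
      exact φ.map_mem_edgeSet_iff.mpr (hM he)
    · rintro _ ⟨e, he, rfl⟩ _ ⟨f, hf, rfl⟩ hne v hve hvf
      obtain ⟨a, ha, rfl⟩ := Sym2.mem_map.mp hve
      obtain ⟨b, hb, hab⟩ := Sym2.mem_map.mp hvf
      exact hdisj e he f hf (fun h => hne (h ▸ rfl)) a ha (φ.injective hab ▸ hb)
    · rintro v ⟨_, ⟨e, -, rfl⟩, hv⟩
      obtain ⟨a, -, rfl⟩ := Sym2.mem_map.mp hv
      exact ⟨a, rfl⟩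
    · exact (Set.ncard_image_of_injective _ hinj).trans hr
  · rintro ⟨⟨hM, hdisj⟩, hcov, hr⟩
    have hsub : M ⊆ Set.range (Sym2.map φ) := by
      intro e he
      induction e with
      | _ a b =>
        obtain ⟨a, rfl⟩ := hcov ⟨_, he, Sym2.mem_mk_left a b⟩
        obtain ⟨b, rfl⟩ := hcov ⟨_, he, Sym2.mem_mk_right _ b⟩
        exact ⟨s(a, b), rfl⟩
    have heq : Sym2.map φ '' (Sym2.map φ ⁻¹' M) = M := Set.image_preimage_eq_of_subset hsub
    refine ⟨Sym2.map φ ⁻¹' M, ⟨⟨?_, ?_⟩, ?_⟩, heq⟩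
    · intro e he
      exact φ.map_mem_edgeSet_iff.mp (hM he)
    · intro e he f hf hne v hve hvf
      exact hdisj _ he _ hf (hinj.ne hne) (φ v) (Sym2.mem_map.mpr ⟨v, hve, rfl⟩)
        (Sym2.mem_map.mpr ⟨v, hvf, rfl⟩)
    · rw [← hr, ← heq, Set.ncard_image_of_injective _ hinj, heq]

theorem matchingsIn_zero [Finite V] (G : SimpleGraph V) (A : Set V) :
    G.matchingsIn A 0 = {∅} := by
  ext M
  constructor
  · rintro ⟨-, -, h⟩
    exact (Set.ncard_eq_zero (Set.toFinite M)).mp h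
  · rintro rfl
    refine ⟨⟨by simp, by simp⟩, ?_, by simp⟩
    rintro v ⟨e, he, -⟩
    exact he.elim

theorem insert_mem_matchingsIn [Finite V] [DecidableEq V] {G : SimpleGraph V}
    {A : Finset V} {u w : V} {r : ℕ} (hu : u ∈ A) (hw : w ∈ A)
    (hadj : G.Adj u w) {M : Set (Sym2 V)}
    (hM : M ∈ G.matchingsIn ↑((A.erase u).erase w) r) :
    insert s(u, w) M ∈ G.matchingsIn ↑A (r + 1) := by
  obtain ⟨⟨hM, hdisj⟩, hcov, hr⟩ := hM
  have hcov' : ∀ f ∈ M, ∀ v ∈ f, v ≠ w ∧ v ≠ u ∧ v ∈ A := fun f hf v hv => by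
    simpa only [Finset.mem_coe, Finset.mem_erase] using hcov ⟨f, hf, hv⟩
  refine ⟨⟨?_, ?_⟩, ?_, ?_⟩
  · exact Set.insert_subset hadj hM
  · rintro e (rfl | he) f (rfl | hf) hne v hve hvf
    · exact hne rfl
    · have := hcov' f hf v hvf
      rcases Sym2.mem_iff.mp hve with rfl | rfl <;> tauto
    · have := hcov' e he v hve
      rcases Sym2.mem_iff.mp hvf with rfl | rfl <;> tauto
    · exact hdisj e he f hf hne v hve hvf
  · rintro v ⟨e, rfl | he, hv⟩
    · rcases Sym2.mem_iff.mp hv with rfl | rfl <;> assumption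
    · exact (hcov' e he v hv).2.2
  · rw [Set.ncard_insert_of_notMem _ (Set.toFinite M), hr]
    intro h
    exact (hcov' _ h u (Sym2.mem_mk_left u w)).2.1 rfl

section

variable [Finite V] [DecidableEq V] {G : SimpleGraph V} [DecidableRel G.Adj]

/-- Matchings are split by whether they cover `u`, and if so by its partner `w`. -/
theorem ncard_matchingsIn_succ {A : Finset V} {u : V} (hu : u ∈ A) (r : ℕ) :
    (G.matchingsIn ↑A (r + 1)).ncard = (G.matchingsIn ↑(A.erase u) (r + 1)).ncard +
      ∑ w ∈ (A.erase u).filter (G.Adj u), (G.matchingsIn ↑((A.erase u).erase w) r).ncard := by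
  classical
  let P : Finset V → ℕ → Finset (Set (Sym2 V)) := fun B r =>
    (Set.toFinite (G.matchingsIn (B : Set V) r)).toFinset
  have hP : ∀ B r M, M ∈ P B r ↔ M ∈ G.matchingsIn (B : Set V) r := fun B r M => by simp [P]
  have hcard : ∀ (B : Finset V) r, (G.matchingsIn (B : Set V) r).ncard = (P B r).card :=
    fun B r => Set.ncard_eq_toFinset_card _ _
  have hnot : ∀ w r M, M ∈ P ((A.erase u).erase w) r → ∀ e ∈ M, u ∉ e := by
    intro w r M hM e he hue
    have := ((hP _ _ _).mp hM).2.1 ⟨e, he, hue⟩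
    simp at this
  have hunion : P A (r + 1) = P (A.erase u) (r + 1) ∪
      ((A.erase u).filter (G.Adj u)).biUnion fun w =>
        (P ((A.erase u).erase w) r).image (insert s(u, w)) := by
    ext M
    simp only [Finset.mem_union, Finset.mem_biUnion, Finset.mem_image, Finset.mem_filter, hP]
    constructor
    · rintro ⟨⟨hM, hdisj⟩, hcov, hr⟩
      by_cases hcu : u ∈ coveredVerts M
      · obtain ⟨e, he, hue⟩ := hcu
        obtain ⟨w, rfl⟩ := Sym2.mem_iff_exists.mp hue
        have hadj : G.Adj u w := hM he
        have hwA : w ∈ A := hcov ⟨_, he, Sym2.mem_mk_right u w⟩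
        refine Or.inr ⟨w, ⟨Finset.mem_erase.mpr ⟨hadj.ne', hwA⟩, hadj⟩, M \ {s(u, w)},
          ⟨⟨Set.sdiff_subset.trans hM, fun e he f hf => hdisj e he.1 f hf.1⟩, ?_, ?_⟩, ?_⟩
        · rintro v ⟨f, ⟨hf, hfe⟩, hv⟩
          have hne : s(u, w) ≠ f := fun h => hfe h.symm
          have h1 : v ∈ A := hcov ⟨f, hf, hv⟩
          have h2 : v ≠ u := by
            rintro rfl; exact hdisj _ he f hf hne _ (Sym2.mem_mk_left _ _) hv
          have h3 : v ≠ w := by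
            rintro rfl; exact hdisj _ he f hf hne _ (Sym2.mem_mk_right _ _) hv
          simp [h1, h2, h3]
        · rw [Set.ncard_sdiff_singleton_of_mem he, hr]; rfl
        · exact Set.insert_sdiff_self_of_mem he
      · refine Or.inl ⟨⟨hM, hdisj⟩, fun v hv => ?_, hr⟩
        have h1 : v ≠ u := by rintro rfl; exact hcu hv
        have h2 : v ∈ A := hcov hv
        simp [h1, h2]
    · rintro (⟨hM, hcov, hr⟩ | ⟨w, ⟨hw, hadj⟩, M, hM, rfl⟩)
      · exact ⟨hM, hcov.trans (by simp), hr⟩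
      · exact insert_mem_matchingsIn hu (Finset.mem_of_mem_erase hw) hadj hM
  rw [hcard, hcard, hunion, Finset.card_union_of_disjoint, Finset.card_biUnion]
  · congr 1
    refine Finset.sum_congr rfl fun w hw => ?_
    rw [hcard, Finset.card_image_of_injOn]
    intro M hM M' hM' h
    have h1 : s(u, w) ∉ M := fun h' => hnot w r M hM _ h' (Sym2.mem_mk_left u w)
    have h2 : s(u, w) ∉ M' := fun h' => hnot w r M' hM' _ h' (Sym2.mem_mk_left u w)
    have := congrArg (fun N => N \ {s(u, w)}) h
    simpa [Set.insert_sdiff_self_of_notMem, h1, h2] using this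
  · intro w hw w' hw' hne
    refine Finset.disjoint_left.mpr fun N hN hN' => ?_
    obtain ⟨M, hM, rfl⟩ := Finset.mem_image.mp hN
    obtain ⟨M', hM', h⟩ := Finset.mem_image.mp hN'
    have : s(u, w') ∈ insert s(u, w) M := h ▸ Set.mem_insert _ _
    rcases this with h1 | h1
    · exact hne (Sym2.congr_right.mp h1).symm
    · exact hnot w r M hM _ h1 (Sym2.mem_mk_left u w')
  · refine Finset.disjoint_left.mpr fun N hN hN' => ?_
    obtain ⟨w, hw, hN'⟩ := Finset.mem_biUnion.mp hN'
    obtain ⟨M, hM, rfl⟩ := Finset.mem_image.mp hN'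
    have := ((hP _ _ _).mp hN).2.1 ⟨s(u, w), Set.mem_insert _ _, Sym2.mem_mk_left u w⟩
    simp at this

theorem ncard_matchingsIn_eq_zero (A : Finset V) {r : ℕ} (h : A.card < 2 * r) :
    (G.matchingsIn (A : Set V) r).ncard = 0 := by
  induction hn : A.card using Nat.strong_induction_on generalizing A r with
  | _ n ih =>
    subst hn
    obtain ⟨r, rfl⟩ : ∃ s, r = s + 1 := ⟨r - 1, by omega⟩
    rcases A.eq_empty_or_nonempty with rfl | ⟨u, hu⟩
    · have : G.matchingsIn ((∅ : Finset V) : Set V) (r + 1) = ∅ := by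
        refine Set.eq_empty_iff_forall_notMem.mpr ?_
        rintro M ⟨-, hcov, hr⟩
        obtain ⟨e, he⟩ : M.Nonempty := Set.nonempty_of_ncard_ne_zero (by omega)
        induction e with
        | _ a b => simpa using hcov ⟨_, he, Sym2.mem_mk_left a b⟩
      rw [this, Set.ncard_empty]
    · have hc := Finset.card_erase_lt_of_mem hu
      rw [ncard_matchingsIn_succ hu, ih _ hc (A.erase u) (by omega) rfl, zero_add]
      refine Finset.sum_eq_zero fun w hw => ?_
      have hc1 := Finset.card_erase_of_mem hu
      have hc' := Finset.card_erase_lt_of_mem (Finset.mem_of_mem_filter w hw)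
      have hc2 := Finset.card_erase_of_mem (Finset.mem_of_mem_filter w hw)
      exact ih _ (hc'.trans hc) _ (by omega) rfl

end

/-! ### Matching polynomials of induced subgraphs, and multiplicities as orders. -/

/-- The matching polynomial of the subgraph of `G` induced on `A`. -/
noncomputable def inducedMatchingPolynomial (G : SimpleGraph V) (A : Finset V) : ℝ[X] :=
  ∑ r ∈ Finset.range (A.card / 2 + 1),
    C ((-1 : ℝ) ^ r * ((G.matchingsIn A r).ncard : ℝ)) * X ^ (A.card - 2 * r)

section

variable [Finite V] [DecidableEq V] {G : SimpleGraph V} [DecidableRel G.Adj]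

theorem inducedMatchingPolynomial_eq_sum_range (A : Finset V) {N : ℕ} (hN : A.card / 2 < N) :
    G.inducedMatchingPolynomial A = ∑ r ∈ Finset.range N,
      C ((-1 : ℝ) ^ r * ((G.matchingsIn A r).ncard : ℝ)) * X ^ (A.card - 2 * r) := by
  refine Finset.sum_subset (Finset.range_subset_range.mpr hN) fun r _ hr => ?_
  rw [Finset.mem_range] at hr
  rw [ncard_matchingsIn_eq_zero A (by omega)]
  simp

variable (G)

theorem isMatchingFamily_inducedMatchingPolynomial :
    G.IsMatchingFamily (fun _ => X) G.inducedMatchingPolynomial := by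
  intro A u hu
  have hc := Finset.card_erase_of_mem hu
  have hpos : 0 < A.card := Finset.card_pos.mpr ⟨u, hu⟩
  rw [inducedMatchingPolynomial_eq_sum_range A (N := A.card + 1) (by omega),
    inducedMatchingPolynomial_eq_sum_range (A.erase u) (N := A.card + 1) (by omega)]
  have h2 : ∑ w ∈ (A.erase u).filter (G.Adj u),
        G.inducedMatchingPolynomial ((A.erase u).erase w) =
      ∑ r ∈ Finset.range A.card, ∑ w ∈ (A.erase u).filter (G.Adj u),
        C ((-1 : ℝ) ^ r * ((G.matchingsIn ↑((A.erase u).erase w) r).ncard : ℝ)) *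
          X ^ (A.card - 2 * (r + 1)) := by
    rw [Finset.sum_comm]
    refine Finset.sum_congr rfl fun w hw => ?_
    have hc' := Finset.card_erase_of_mem (Finset.mem_of_mem_filter w hw)
    rw [inducedMatchingPolynomial_eq_sum_range _ (N := A.card) (by omega)]
    refine Finset.sum_congr rfl fun r _ => ?_
    congr 2
    omega
  have h1 : X * ∑ r ∈ Finset.range (A.card + 1),
        C ((-1 : ℝ) ^ r * ((G.matchingsIn ↑(A.erase u) r).ncard : ℝ)) *
          X ^ ((A.erase u).card - 2 * r) =
      ∑ r ∈ Finset.range (A.card + 1),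
        C ((-1 : ℝ) ^ r * ((G.matchingsIn ↑(A.erase u) r).ncard : ℝ)) *
          X ^ (A.card - 2 * r) := by
    rw [Finset.mul_sum]
    refine Finset.sum_congr rfl fun r _ => ?_
    -- Where the exponent subtraction truncates, the coefficient vanishes.
    by_cases hr : (A.erase u).card < 2 * r
    · rw [ncard_matchingsIn_eq_zero (A.erase u) hr]; simp
    · rw [show A.card - 2 * r = (A.erase u).card - 2 * r + 1 by omega, pow_succ]
      ring
  -- Splitting off `r = 0` aligns index `r + 1` here with index `r` in the neighbour sum.
  rw [h1, h2, Finset.sum_range_succ', Finset.sum_range_succ' (n := A.card), matchingsIn_zero,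
    matchingsIn_zero, add_sub_right_comm, ← Finset.sum_sub_distrib]
  congr 1
  refine Finset.sum_congr rfl fun r _ => ?_
  rw [ncard_matchingsIn_succ hu, ← Finset.sum_mul, ← sub_mul]
  congr 1
  simp only [← map_sum, ← C_sub, ← Finset.mul_sum]
  congr 1
  push_cast
  ring

end

section

variable (G : SimpleGraph V)

theorem coeff_card_inducedMatchingPolynomial [Finite V] (A : Finset V) :
    (G.inducedMatchingPolynomial A).coeff A.card = 1 := by
  rw [inducedMatchingPolynomial, Finset.sum_range_succ', coeff_add, finsetSum_coeff,
    Finset.sum_eq_zero, matchingsIn_zero]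
  · simp
  · intro r hr
    rw [Finset.mem_range] at hr
    rw [coeff_C_mul, coeff_X_pow, if_neg (by omega), mul_zero]

theorem matchingPolynomial_eq_inducedMatchingPolynomial {W : Type*} {H : SimpleGraph W}
    (φ : H ↪g G) {A : Finset V} (hA : Set.range φ = A) :
    H.matchingPolynomial = G.inducedMatchingPolynomial A := by
  have hc : Nat.card W = A.card := by
    rw [← Set.ncard_coe_finset, ← hA, ← Set.image_univ,
      Set.ncard_image_of_injective _ φ.injective, Set.ncard_univ]
  simp only [matchingPolynomial, inducedMatchingPolynomial, hc,
    numMatchings_eq_ncard_matchingsIn φ, hA]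

end

/-- The matching polynomial of the subgraph of `G` induced on `A`, translated by `θ`. -/
noncomputable def shiftedMatchingPolynomial (G : SimpleGraph V) (θ : ℝ) (A : Finset V) : ℝ[X] :=
  (G.inducedMatchingPolynomial A).comp (X + C θ)

section

variable (G : SimpleGraph V) (θ : ℝ)

theorem shiftedMatchingPolynomial_ne_zero (A : Finset V) [Finite V] :
    G.shiftedMatchingPolynomial θ A ≠ 0 := by
  intro h
  have h1 : G.inducedMatchingPolynomial A = 0 := by
    have := congrArg (fun p => p.comp (X - C θ)) h
    simpa [shiftedMatchingPolynomial, comp_assoc] using this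
  have := G.coeff_card_inducedMatchingPolynomial A
  rw [h1] at this
  simp at this

theorem isMatchingFamily_shiftedMatchingPolynomial [Finite V] [DecidableEq V]
    [DecidableRel G.Adj] :
    G.IsMatchingFamily (fun _ => X + C θ) (G.shiftedMatchingPolynomial θ) := by
  have h : G.shiftedMatchingPolynomial θ =
      fun A => (G.inducedMatchingPolynomial A).comp (X + C θ) := rfl
  rw [h]
  simpa using G.isMatchingFamily_inducedMatchingPolynomial.map (compRingHom (X + C θ))

theorem mult_eq_natTrailingDegree {W : Type*} {H : SimpleGraph W} (φ : H ↪g G)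
    {A : Finset V} (hA : Set.range φ = A) :
    mult θ H = (G.shiftedMatchingPolynomial θ A).natTrailingDegree := by
  rw [mult, G.matchingPolynomial_eq_inducedMatchingPolynomial φ hA,
    rootMultiplicity_eq_natTrailingDegree, shiftedMatchingPolynomial]

theorem mult_del {S : Set V} {A : Finset V} (hA : (A : Set V) = Sᶜ) :
    mult θ (G.del S) = (G.shiftedMatchingPolynomial θ A).natTrailingDegree :=
  G.mult_eq_natTrailingDegree θ (Embedding.induce Sᶜ) (by rw [hA]; exact Subtype.range_coe)

theorem mult_del_del {S : Set V} {T : Set ↥Sᶜ} {A : Finset V}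
    (hA : (A : Set V) = Sᶜ \ (Subtype.val '' T)) :
    mult θ ((G.del S).del T) = (G.shiftedMatchingPolynomial θ A).natTrailingDegree := by
  refine G.mult_eq_natTrailingDegree θ
    ((Embedding.induce (G := G) Sᶜ).comp (Embedding.induce (G := G.del S) Tᶜ)) ?_
  rw [hA]
  ext v
  constructor
  · rintro ⟨⟨⟨a, ha⟩, ha'⟩, rfl⟩
    refine ⟨ha, ?_⟩
    rintro ⟨b, hb, hba⟩
    exact ha' (by rwa [show b = ⟨a, ha⟩ from Subtype.ext hba] at hb)
  · rintro ⟨h1, h2⟩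
    exact ⟨⟨⟨v, h1⟩, fun h => h2 ⟨_, h, rfl⟩⟩, rfl⟩

variable [Fintype V]

theorem mult_eq_univ : mult θ G = (G.shiftedMatchingPolynomial θ Finset.univ).natTrailingDegree :=
  G.mult_eq_natTrailingDegree θ (Embedding.refl (G := G)) (by rw [Finset.coe_univ]; exact Set.range_id)

theorem IsNice.isRaising [DecidableEq V] {G : SimpleGraph V} {θ : ℝ} {X : Finset V}
    (h : IsNice θ G (X : Set V)) :
    IsRaising (G.shiftedMatchingPolynomial θ) Finset.univ X (mult θ G) := by
  classical
  have hf := G.isMatchingFamily_shiftedMatchingPolynomial θ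
  have h0 := fun A => G.shiftedMatchingPolynomial_ne_zero θ A
  obtain ⟨hc, h⟩ := h
  have h2 : ∀ u ∈ X, ∀ v ∈ X, u ≠ v → (G.shiftedMatchingPolynomial θ
      ((Finset.univ.erase u).erase v)).natTrailingDegree = mult θ G + 2 := by
    intro u hu v hv huv
    rw [← h u hu v hv huv]
    refine (G.mult_del θ ?_).symm
    ext w
    simp
  refine ⟨Finset.subset_univ X, (G.mult_eq_univ θ).symm, fun u hu => ?_, h2⟩
  -- A second element `v` squeezes the order after deleting `u`: two deletions gain two, each at
  -- most one.
  obtain ⟨v, hv, hvu⟩ := Set.exists_ne_of_one_lt_ncard hc u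
  have h3 := h2 u hu v hv hvu.symm
  have h4 := hf.natTrailingDegree_erase_le h0 Finset.univ (Finset.mem_univ u)
  have h5 := hf.natTrailingDegree_erase_le h0 (Finset.univ.erase u) (u := v) (by simp [hvu])
  rw [← mult_eq_univ] at h4
  omega

end

end SimpleGraph

/-! ### The theorem. -/

theorem mainTheorem6 {V : Type*} [Finite V] (G : SimpleGraph V) (θ : ℝ) (k m : ℕ)
    (x : Fin m → V) (hx : Function.Injective x)
    (hnice : SimpleGraph.IsNice θ G (Set.range x)) (hk : SimpleGraph.mult θ G = k) :
    ∃ y : Fin m → V, Function.Injective y ∧ Disjoint (Set.range x) (Set.range y) ∧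
      ∃ M : Set (Sym2 V), M = Set.range (fun i => s(x i, y i)) ∧
        (G.IsEdgeMatching M ∧ M.ncard = m) ∧
        (∀ M' ⊆ M,
          SimpleGraph.mult θ (G.del (SimpleGraph.coveredVerts M')) = k ∧
          (2 ≤ (Set.range x \ SimpleGraph.coveredVerts M').ncard →
            SimpleGraph.IsNice θ (G.del (SimpleGraph.coveredVerts M'))
              (Subtype.val ⁻¹' (Set.range x \ SimpleGraph.coveredVerts M')))) ∧
        G.IsIndepSet (Set.range y) := by
  classical
  have := Fintype.ofFinite V
  have hf := G.isMatchingFamily_shiftedMatchingPolynomial θ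
  have h0 := fun A => G.shiftedMatchingPolynomial_ne_zero θ A
  have hrange : Set.range x = ((Finset.univ.image x : Finset V) : Set V) := by simp
  rw [hrange] at hnice
  have hR := hnice.isRaising
  have hX : ∀ i, x i ∈ Finset.univ.image x := fun i =>
    Finset.mem_image_of_mem x (Finset.mem_univ i)
  obtain ⟨y, hy⟩ := hR.exists_isGoodMatching hf h0 hx hX Finset.univ
  have hyinj : Function.Injective y := fun i j h => hy.injOn (by simp) (by simp) h
  have hxy : ∀ i j, x i ≠ y j := fun i j h => hy.notMem j (Finset.mem_univ j) (h ▸ hX i)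
  have hinj : Function.Injective fun i => s(x i, y i) := by
    intro i j h
    rcases Sym2.eq_iff.mp h with ⟨h, -⟩ | ⟨h, -⟩
    · exact hx h
    · exact absurd h (hxy i j)
  refine ⟨y, hyinj, ?_, _, rfl, ⟨⟨?_, ?_⟩, ?_⟩, ?_, ?_⟩
  · rw [Set.disjoint_left]
    rintro _ ⟨i, rfl⟩ ⟨j, hj⟩
    exact hxy i j hj.symm
  · rintro _ ⟨i, rfl⟩
    exact hy.adj i (Finset.mem_univ i)
  · rintro _ ⟨i, rfl⟩ _ ⟨j, rfl⟩ hne v hv hv'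
    have hij : i ≠ j := by rintro rfl; exact hne rfl
    rcases Sym2.mem_iff.mp hv with rfl | rfl <;> rcases Sym2.mem_iff.mp hv' with h | h
    · exact hij (hx h)
    · exact hxy _ _ h
    · exact hxy _ _ h.symm
    · exact hij (hyinj h)
  · rw [← Set.image_univ, Set.ncard_image_of_injective _ hinj, Set.ncard_univ, Nat.card_fin]
  · intro M' hM'
    -- `M'` is encoded by the indices of its edges, so the case of `M'` is the good matching
    -- restricted to `J`.
    let J : Finset (Fin m) := Finset.univ.filter fun i => s(x i, y i) ∈ M'
    have hJ := hy.mono hf h0 hR hx hX (Finset.subset_univ J)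
    have hcov : ∀ v, v ∈ SimpleGraph.coveredVerts M' ↔ v ∈ J.image x ∨ v ∈ J.image y := by
      intro v
      constructor
      · rintro ⟨e, he, hv⟩
        obtain ⟨i, rfl⟩ := hM' he
        rcases Sym2.mem_iff.mp hv with rfl | rfl
        · exact Or.inl (Finset.mem_image_of_mem x (by simpa [J] using he))
        · exact Or.inr (Finset.mem_image_of_mem y (by simpa [J] using he))
      · rintro (h | h) <;> obtain ⟨i, hi, rfl⟩ := Finset.mem_image.mp h <;>
          refine ⟨s(x i, y i), by simpa [J] using hi, by simp⟩
    have hdel : SimpleGraph.mult θ (G.del (SimpleGraph.coveredVerts M')) = k := by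
      rw [← hk, ← hJ.order]
      refine G.mult_del θ ?_
      ext v
      simp only [Finset.mem_coe, Finset.mem_sdiff, Finset.mem_univ, true_and, Set.mem_compl_iff,
        hcov, not_or]
    refine ⟨hdel, fun hcard => ⟨?_, ?_⟩⟩
    · rw [Set.ncard_preimage_of_injective_subset_range Subtype.val_injective]
      · exact hcard
      · rw [Subtype.range_coe]
        exact fun v hv => hv.2
    · rintro ⟨u, hu⟩ ⟨huX, -⟩ ⟨v, hv⟩ ⟨hvX, -⟩ huv
      rw [hdel, ← hk]
      simp only [Set.mem_compl_iff, hcov, not_or] at hu hv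
      rw [← hJ.order_erase_erase hf h0 hR hx hX (u := u) (v := v)
        (by simpa using huX) (by simpa using hvX) (fun h => huv (Subtype.ext h)) hu.1 hv.1]
      refine G.mult_del_del θ ?_
      ext w
      simp only [Finset.mem_coe, Finset.mem_erase, Finset.mem_sdiff, Finset.mem_univ, true_and,
        Set.image_pair, Set.mem_sdiff, Set.mem_compl_iff, hcov, not_or, Set.mem_insert_iff,
        Set.mem_singleton_iff]
      tauto
  · rintro _ ⟨i, rfl⟩ _ ⟨j, rfl⟩ hne
    exact hy.not_adj hf h0 hR hx hX (Finset.mem_univ i) (Finset.mem_univ j) fun h => hne (h ▸ rfl)
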